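/- Let $H$ be a complex Hilbert space and let $E$ be a resolution of the identity on the Borel subsets of $\mathbb{R}$: each $E(\beta)$ is an orthogonal projection in $H$, $E(\emptyset)=0$, $E(\mathbb{R})=I$, and $E\bigl(\bigcup_j\beta_j\bigr)x=\sum_j E(\beta_j)x$ for all $x\in H$ and all sequences of pairwise disjoint Borel sets $\beta_j$. For $\sigma>0$ and $x\in H$ put $$W_\sigma=\Bigl\{\int_{|s|<\sigma}dE(s)g : g\in H\Bigr\},\qquad E_\sigma(x)=\inf_{h\in W_\sigma}\|x-h\|.$$ For a continuous function $\varphi:\mathbb{C}\to\mathbb{C}$ put $\psi(t)=|\varphi(e^{it})|^2$, $t\in\mathbb{R}$, and $$\Delta_t^\varphi x=\int_{-\infty}^{\infty}\varphi(e^{its})\,dE(s)x,\qquad \omega_\varphi(x;\delta)=\max_{0\le t\le\delta}\|\Delta_t^\varphi x\|,$$ $$\omega_\varphi(x;L_{p,V}([0,\delta]))=\Bigl(\frac1\delta\int_0^\delta\|\Delta_t^\varphi x\|^p\,V\Bigl(\frac t\delta\Bigr)dt\Bigr)^{1/p}\quad(1\le p<\infty),\qquad \mathcal{I}(\psi)=\frac1{2\pi}\int_0^{2\pi}\psi(t)\,dt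 .$$ Let $\Psi$ be the class of continuous, nonnegative, $2\pi$-periodic functions $\psi:\mathbb{R}\to\mathbb{R}$ with nowhere dense zero set and $\psi(0)=0$ such that $\psi(-t)=\psi(t)$ and $\psi(\pi-t)=\psi(\pi+t)$ for all $t\in\mathbb{R}$, and $$\frac1t\int_0^t\psi(s)\,ds\le\frac1\pi\int_0^\pi\psi(s)\,ds\qquad\text{for all }t\in(0,\pi).$$ Let $V^*=Z/\|Z\|_{L_1([0,1])}$, where $$Z(t)=\begin{cases}\frac{2t}{7}, & t\in[0,\frac17],\\[2pt] -\frac{t^2}{2}+\frac{3t}{7}-\frac1{98}, & t\in[\frac17,\frac57],\\[2pt] \frac{t^2}{2}-t+\frac12, & t\in[\frac57,1].\end{cases}$$ **Theorem.** Let $\varphi:\mathbb{C}\to\mathbb{C}$ be continuous with $\psi\in\Psi$. Then for every $\gamma\ge\frac{7\pi}{5}$, every $x\in H$ and every $\sigma>0$, $$E_\sigma(x)\le\frac1{\sqrt{\mathcal{I}(\psi)}}\;\omega_\varphi\bigl(x;L_{p,V^*}([0,\gamma/\sigma])\bigr)\quad\text{for all } 2\le p<\infty,$$ and (the case $p=\infty$)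 $$E_\sigma(x)\le\frac1{\sqrt{\mathcal{I}(\psi)}}\;\omega_\varphi\Bigl(x;\frac\gamma\sigma\Bigr).$$ -/

import Mathlib

open MeasureTheory Set Filter Topology

noncomputable section

namespace JacksonStechkin

/-! ### Resolutions of the identity and spectral integrals -/

/-- A resolution of the identity on the Borel sets of the real line: a strongly countably additive
family of orthogonal projections of `H` with `E ∅ = 0` and `E ℝ = I`.
(The values of `proj` on sets that are not Borel play no role.) -/
structure ResolutionOfIdentity (H : Type*) [NormedAddCommGroup H] [InnerProductSpace ℂ H]
    [CompleteSpace H] where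
  /-- the projection `E(β)` -/
  proj : Set ℝ → H →L[ℂ] H
  isStarProjection : ∀ β, MeasurableSet β → IsStarProjection (proj β)
  proj_empty : proj ∅ = 0
  proj_univ : proj univ = 1
  hasSum_iUnion : ∀ β : ℕ → Set ℝ, (∀ j, MeasurableSet (β j)) →
    Pairwise (fun i j => Disjoint (β i) (β j)) →
    ∀ x : H, HasSum (fun j => proj (β j) x) (proj (⋃ j, β j) x)

namespace ResolutionOfIdentity

variable {H : Type*} [NormedAddCommGroup H] [InnerProductSpace ℂ H] [CompleteSpace H]
  (E : ResolutionOfIdentity H)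

/-- The integral `∫ S(s) dE(s) x = ∑ c E({S = c}) x` of a simple function `S`. -/
def simpleIntegral (S : SimpleFunc ℝ ℂ) (x : H) : H :=
  ∑ c ∈ S.range, c • E.proj (S ⁻¹' {c}) x

/-- The spectral integral `∫ F(s) dE(s) x` of a measurable function `F`: the limit of the integrals
of simple functions approximating `F`. It exists, and does not depend on the choice of the
approximating sequence, as soon as `∫ |F(s)|² d(E(s)x, x) < ∞`: see
`tendsto_simpleIntegral` below. -/
def integral (F : ℝ → ℂ) (hF : Measurable F) (x : H) : H :=
  limUnder atTop (fun n => E.simpleIntegral (SimpleFunc.approxOn F hF univ 0 (mem_univ 0) n) x)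

theorem norm_proj_sq (β : Set ℝ) (hβ : MeasurableSet β) (x : H) :
    (inner ℂ (E.proj β x) x).re = ‖E.proj β x‖ ^ 2 := by
  have h := E.isStarProjection β hβ
  have h1 : E.proj β (E.proj β x) = E.proj β x := by
    have := congrArg (fun T : H →L[ℂ] H => T x) h.isIdempotentElem.eq
    simpa using this
  have h2 : inner ℂ (E.proj β (E.proj β x)) x = inner ℂ (E.proj β x) (E.proj β x) := by
    rw [← ContinuousLinearMap.adjoint_inner_right, ← ContinuousLinearMap.star_eq_adjoint,
      h.isSelfAdjoint.star_eq]
  rw [h1] at h2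
  rw [h2]
  exact inner_self_eq_norm_sq (𝕜 := ℂ) _

theorem proj_union (β β' : Set ℝ) (hβ : MeasurableSet β) (hβ' : MeasurableSet β')
    (hd : Disjoint β β') (x : H) :
    E.proj (β ∪ β') x = E.proj β x + E.proj β' x := by
  have hs := E.hasSum_iUnion (fun j => if j = 0 then β else if j = 1 then β' else ∅)
    (fun j => by split_ifs <;> simp [*]) (fun i j hij => by
      simp only
      split_ifs <;> simp_all [hd.symm]) x
  have hU : (⋃ j : ℕ, if j = 0 then β else if j = 1 then β' else ∅) = β ∪ β' := by
    ext s
    simp only [mem_iUnion, mem_union]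
    constructor
    · rintro ⟨j, hj⟩
      split_ifs at hj <;> simp_all
    · rintro (h | h)
      · exact ⟨0, by simpa using h⟩
      · exact ⟨1, by simpa using h⟩
  rw [hU] at hs
  have hf : HasSum (fun j : ℕ => E.proj (if j = 0 then β else if j = 1 then β' else ∅) x)
      (∑ j ∈ Finset.range 2, E.proj (if j = 0 then β else if j = 1 then β' else ∅) x) :=
    hasSum_sum_of_ne_finset_zero (fun j hj => by
      have : j ≠ 0 ∧ j ≠ 1 := by simp at hj; omega
      simp [this.1, this.2, E.proj_empty])
  rw [hs.unique hf]
  simp [Finset.sum_range_succ]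

theorem inner_proj_proj (β β' : Set ℝ) (hβ : MeasurableSet β) (hβ' : MeasurableSet β')
    (hd : Disjoint β β') (x : H) : inner ℂ (E.proj β x) (E.proj β' x) = 0 := by
  have h' := E.isStarProjection β' hβ'
  have hid : E.proj β' (E.proj β' x) = E.proj β' x := by
    have := congrArg (fun T : H →L[ℂ] H => T x) h'.isIdempotentElem.eq
    simpa using this
  have key : E.proj β (E.proj β' x) = 0 := by
    set y := E.proj β' x
    have hu := E.norm_proj_sq _ (hβ.union hβ') y
    have h1 := E.norm_proj_sq _ hβ y
    rw [E.proj_union β β' hβ hβ' hd, hid, inner_add_left, Complex.add_re, h1] at hu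
    have h2 : (inner ℂ y y).re = ‖y‖ ^ 2 := inner_self_eq_norm_sq (𝕜 := ℂ) _
    have h3 : ‖E.proj (β ∪ β') y‖ ≤ ‖y‖ := by
      have hb := E.norm_proj_sq _ (hβ.union hβ') y
      have hc : (inner ℂ (E.proj (β ∪ β') y) y).re ≤ ‖E.proj (β ∪ β') y‖ * ‖y‖ :=
        re_inner_le_norm (𝕜 := ℂ) _ _
      rw [hb] at hc
      by_contra hlt
      push Not at hlt
      nlinarith [norm_nonneg y]
    rw [E.proj_union β β' hβ hβ' hd, hid] at h3
    have h4 : ‖E.proj β y + y‖ ^ 2 ≤ ‖y‖ ^ 2 := by gcongr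
    have h5 : ‖E.proj β y‖ ^ 2 ≤ 0 := by linarith
    simpa using h5
  have hb := E.isStarProjection β hβ
  rw [← ContinuousLinearMap.adjoint_inner_right, ← ContinuousLinearMap.star_eq_adjoint,
    hb.isSelfAdjoint.star_eq, key, inner_zero_right]

/-- The finite measure `β ↦ (E(β)x, x)`. -/
def scalarMeasure (x : H) : Measure ℝ :=
  Measure.ofMeasurable (fun β _ => ENNReal.ofReal (inner ℂ (E.proj β x) x).re)
    (by simp [E.proj_empty])
    (fun β hβ hd => by
      have h0 : ∀ j, 0 ≤ (inner ℂ (E.proj (β j) x) x).re := fun j => by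
        rw [E.norm_proj_sq _ (hβ j)]; positivity
      have hs : HasSum (fun j => (inner ℂ (E.proj (β j) x) x).re)
          (inner ℂ (E.proj (⋃ j, β j) x) x).re := by
        have h1 := (E.hasSum_iUnion β hβ hd x).mapL (innerSL ℂ x)
        have h2 := Complex.reCLM.hasSum h1
        have h3 : ∀ y : H, (inner ℂ y x).re = (inner ℂ x y).re :=
          fun y => inner_re_symm (𝕜 := ℂ) y x
        simpa [h3] using h2
      rw [← hs.tsum_eq, ENNReal.ofReal_tsum_of_nonneg h0 hs.summable])

theorem scalarMeasure_apply (x : H) (β : Set ℝ) (hβ : MeasurableSet β) :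
    E.scalarMeasure x β = ENNReal.ofReal (‖E.proj β x‖ ^ 2) := by
  rw [scalarMeasure, Measure.ofMeasurable_apply _ hβ, E.norm_proj_sq _ hβ]

instance isFiniteMeasure_scalarMeasure (x : H) : IsFiniteMeasure (E.scalarMeasure x) :=
  ⟨by rw [E.scalarMeasure_apply x _ MeasurableSet.univ]; exact ENNReal.ofReal_lt_top⟩

/-- `‖∫ S(s) dE(s) x‖² = ∫ |S(s)|² d(E(s)x, x)` for simple functions. -/
theorem enorm_simpleIntegral (S : SimpleFunc ℝ ℂ) (x : H) :
    ‖E.simpleIntegral S x‖ₑ = eLpNorm S 2 (E.scalarMeasure x) := by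
  have h1 : ‖E.simpleIntegral S x‖ ^ 2
      = ∑ c ∈ S.range, ‖c‖ ^ 2 * ‖E.proj (S ⁻¹' {c}) x‖ ^ 2 := by
    have : (inner ℂ (E.simpleIntegral S x) (E.simpleIntegral S x)).re
        = ‖E.simpleIntegral S x‖ ^ 2 := inner_self_eq_norm_sq (𝕜 := ℂ) _
    rw [← this, simpleIntegral, sum_inner, Complex.re_sum]
    refine Finset.sum_congr rfl fun c hc => ?_
    rw [inner_sum, Finset.sum_eq_single c]
    · have h := inner_self_eq_norm_sq (𝕜 := ℂ) (c • E.proj (S ⁻¹' {c}) x)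
      rw [norm_smul, mul_pow] at h
      exact h
    · intro d _ hdc
      rw [inner_smul_left, inner_smul_right, E.inner_proj_proj _ _ (S.measurableSet_fiber c)
        (S.measurableSet_fiber d) (by
          rw [Set.disjoint_left]
          intro s hs hs'
          simp only [mem_preimage, mem_singleton_iff] at hs hs'
          exact hdc (hs'.symm.trans hs))]
      simp
    · exact fun h => absurd hc h
  have h2 : eLpNorm S 2 (E.scalarMeasure x) ^ (2 : ℝ) = ‖E.simpleIntegral S x‖ₑ ^ (2 : ℝ) := by
    have h3 := eLpNorm_nnreal_pow_eq_lintegral (f := S) (p := 2) (μ := E.scalarMeasure x)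
      (by norm_num)
    have h4 : ∫⁻ s, ‖S s‖ₑ ^ (2 : ℝ) ∂E.scalarMeasure x
        = ∑ c ∈ S.range, ‖c‖ₑ ^ (2 : ℝ) * E.scalarMeasure x (S ⁻¹' {c}) := by
      rw [← SimpleFunc.map_lintegral (fun c : ℂ => ‖c‖ₑ ^ (2 : ℝ)),
        ← SimpleFunc.lintegral_eq_lintegral]
      rfl
    have h5 : ‖E.simpleIntegral S x‖ₑ ^ (2 : ℝ)
        = ENNReal.ofReal (‖E.simpleIntegral S x‖ ^ 2) := by
      rw [ENNReal.ofReal_pow (norm_nonneg _), ofReal_norm, ENNReal.rpow_two]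
    rw [h5, h1, ENNReal.ofReal_sum_of_nonneg (fun c _ => by positivity)]
    refine (h3.trans h4).trans (Finset.sum_congr rfl fun c _ => ?_)
    rw [E.scalarMeasure_apply x _ (S.measurableSet_fiber c),
      ENNReal.ofReal_mul (by positivity), ENNReal.ofReal_pow (norm_nonneg c), ofReal_norm,
      ENNReal.rpow_two]
  exact ((ENNReal.rpow_left_injective (by norm_num : (2 : ℝ) ≠ 0)) h2).symm

theorem simpleIntegral_sub (S R : SimpleFunc ℝ ℂ) (x : H) :
    E.simpleIntegral (S - R) x = E.simpleIntegral S x - E.simpleIntegral R x := by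
  let T : Set ℝ → ℂ →L[ℝ] H := fun β =>
    ((1 : ℂ →L[ℂ] ℂ).smulRight (E.proj β x)).restrictScalars ℝ
  have hT : FinMeasAdditive (E.scalarMeasure x) T := fun s t hs ht _ _ hd => by
    ext; simp [T, E.proj_union s t hs ht hd x]
  have hS : ∀ S : SimpleFunc ℝ ℂ, E.simpleIntegral S x = S.setToSimpleFunc T := fun S => by
    simp [simpleIntegral, SimpleFunc.setToSimpleFunc, T]
  rw [hS, hS, hS, SimpleFunc.setToSimpleFunc_sub T hT S.integrable_of_isFiniteMeasure
    R.integrable_of_isFiniteMeasure]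

/-- The spectral integral of `F ∈ L²(d(E(s)x, x))` is the limit of the integrals of any sequence
of simple functions converging to `F` in `L²(d(E(s)x, x))`. -/
theorem tendsto_simpleIntegral (F : ℝ → ℂ) (hF : Measurable F) (x : H)
    (hF2 : MemLp F 2 (E.scalarMeasure x)) (S : ℕ → SimpleFunc ℝ ℂ)
    (hS : Tendsto (fun n => eLpNorm (⇑(S n) - F) 2 (E.scalarMeasure x)) atTop (𝓝 0)) :
    Tendsto (fun n => E.simpleIntegral (S n) x) atTop (𝓝 (E.integral F hF x)) := by
  have dist_le : ∀ S R : SimpleFunc ℝ ℂ, edist (E.simpleIntegral S x) (E.simpleIntegral R x)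
      ≤ eLpNorm (⇑S - F) 2 (E.scalarMeasure x) + eLpNorm (⇑R - F) 2 (E.scalarMeasure x) := by
    intro S R
    rw [edist_eq_enorm_sub, ← E.simpleIntegral_sub, E.enorm_simpleIntegral]
    have : (⇑(S - R) : ℝ → ℂ) = (⇑S - F) - (⇑R - F) := by ext; simp
    rw [this]
    exact eLpNorm_sub_le (S.aestronglyMeasurable.sub hF.aestronglyMeasurable)
      (R.aestronglyMeasurable.sub hF.aestronglyMeasurable) (by norm_num)
  set A : ℕ → SimpleFunc ℝ ℂ := fun n => SimpleFunc.approxOn F hF univ 0 (mem_univ 0) n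
  have hA : Tendsto (fun n => eLpNorm (⇑(A n) - F) 2 (E.scalarMeasure x)) atTop (𝓝 0) :=
    SimpleFunc.tendsto_approxOn_Lp_eLpNorm hF (mem_univ 0) (by norm_num) (by simp)
      (by simpa using hF2.2)
  have hc : CauchySeq (fun n => E.simpleIntegral (A n) x) := by
    rw [EMetric.cauchySeq_iff]
    intro ε hε
    obtain ⟨N, hN⟩ := eventually_atTop.1 (hA.eventually_lt_const (ENNReal.half_pos hε.ne'))
    refine ⟨N, fun m hm n hn => (dist_le _ _).trans_lt ?_⟩
    rw [← ENNReal.add_halves ε]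
    exact ENNReal.add_lt_add (hN m hm) (hN n hn)
  have hl : Tendsto (fun n => E.simpleIntegral (A n) x) atTop (𝓝 (E.integral F hF x)) :=
    tendsto_nhds_limUnder (cauchySeq_tendsto_of_complete hc)
  rw [tendsto_iff_edist_tendsto_0] at hl ⊢
  refine tendsto_of_tendsto_of_tendsto_of_le_of_le tendsto_const_nhds
    (h := fun n => (eLpNorm (⇑(S n) - F) 2 (E.scalarMeasure x)
      + eLpNorm (⇑(A n) - F) 2 (E.scalarMeasure x))
      + edist (E.simpleIntegral (A n) x) (E.integral F hF x))
    (by simpa using (hS.add hA).add hl) (fun _ => zero_le)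
    (fun n => (edist_triangle _ (E.simpleIntegral (A n) x) _).trans (add_le_add_left (dist_le _ _) _))

end ResolutionOfIdentity

/-! ### Best approximation -/

section Approximation

variable {H : Type*} [NormedAddCommGroup H] [InnerProductSpace ℂ H] [CompleteSpace H]

/-- The subspace `W_σ = {∫_{|s|<σ} dE(s) g : g ∈ H}`, i.e. the range of `E((-σ, σ))`. -/
def spectralSubspace (E : ResolutionOfIdentity H) (σ : ℝ) : Submodule ℂ H :=
  LinearMap.range (E.proj (Ioo (-σ) σ)).toLinearMap

/-- The best approximation `E_σ(x) = inf_{h ∈ W_σ} ‖x - h‖`. -/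
def bestApprox (E : ResolutionOfIdentity H) (σ : ℝ) (x : H) : ℝ :=
  ⨅ h : spectralSubspace E σ, ‖x - h‖

/-! ### Generalized differences and moduli of continuity -/

/-- The generalized difference `Δ_t^φ x = ∫ φ(e^{its}) dE(s) x`. -/
def genDiff (E : ResolutionOfIdentity H) (φ : C(ℂ, ℂ)) (t : ℝ) (x : H) : H :=
  E.integral (fun s : ℝ => φ (Complex.exp (Complex.I * t * s)))
    (φ.continuous.comp (by fun_prop)).measurable x

/-- The generalized modulus of continuity `ω_φ(x; δ) = max_{0 ≤ t ≤ δ} ‖Δ_t^φ x‖`. -/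
def modulus (E : ResolutionOfIdentity H) (φ : C(ℂ, ℂ)) (x : H) (δ : ℝ) : ℝ :=
  sSup ((fun t => ‖genDiff E φ t x‖) '' Icc 0 δ)

/-- The averaged modulus
`ω_φ(x; L_{p,V}([0,δ])) = (δ⁻¹ ∫_0^δ ‖Δ_t^φ x‖^p V(t/δ) dt)^{1/p}`, `1 ≤ p < ∞`. -/
def avgModulus (E : ResolutionOfIdentity H) (φ : C(ℂ, ℂ)) (x : H) (p : ℝ) (V : ℝ → ℝ)
    (δ : ℝ) : ℝ :=
  (1 / δ * ∫ t in (0 : ℝ)..δ, ‖genDiff E φ t x‖ ^ p * V (t / δ)) ^ (1 / p)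

end Approximation

/-! ### The classes of functions and the weight -/

/-- `ψ(t) = |φ(e^{it})|²`. -/
def psi (φ : C(ℂ, ℂ)) (t : ℝ) : ℝ := ‖φ (Complex.exp (Complex.I * t))‖ ^ 2

/-- The class `Φ`. -/
structure IsClassPhi (ψ : ℝ → ℝ) : Prop where
  continuous : Continuous ψ
  nonneg : ∀ t, 0 ≤ ψ t
  periodic : Function.Periodic ψ (2 * Real.pi)
  nowhereDense_zeros : IsNowhereDense {t | ψ t = 0}
  map_zero : ψ 0 = 0

/-- The class `Ψ ⊆ Φ`. -/
structure IsClassPsi (ψ : ℝ → ℝ) : Prop extends IsClassPhi ψ where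
  even : ∀ t, ψ (-t) = ψ t
  symm_pi : ∀ t, ψ (Real.pi - t) = ψ (Real.pi + t)
  average_le : ∀ t ∈ Ioo 0 Real.pi,
    1 / t * ∫ s in (0 : ℝ)..t, ψ s ≤ 1 / Real.pi * ∫ s in (0 : ℝ)..Real.pi, ψ s

/-- The mean value `𝓘(ψ)` over a period. -/
def meanValue (ψ : ℝ → ℝ) : ℝ :=
  1 / (2 * Real.pi) * ∫ t in (0 : ℝ)..(2 * Real.pi), ψ t

/-- The piecewise quadratic function `Z` on `[0, 1]` (only its values on `[0, 1]` matter). -/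
def weightZ (t : ℝ) : ℝ :=
  if t ≤ 1 / 7 then 2 * t / 7
  else if t ≤ 5 / 7 then -t ^ 2 / 2 + 3 * t / 7 - 1 / 98
  else t ^ 2 / 2 - t + 1 / 2

/-- The weight `V* = Z / ‖Z‖₁`, the norm being that of `L₁([0, 1])`. -/
def weightVstar (t : ℝ) : ℝ := weightZ t / ∫ s in (0 : ℝ)..1, |weightZ s|

end JacksonStechkin

end

/-!
Let `μ` be the finite measure `β ↦ (E(β)x, x)`. Since `x - E((-σ, σ))x = E(ℝ \ (-σ, σ))x`, the
square of the best approximation is at most `μ(|s| ≥ σ)`, while `‖Δ_t^φ x‖² = ∫ ψ(ts) dμ(s)`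
(`norm_genDiff_sq`). Integrate the latter against `V*(t/δ) dt / δ`, `δ = γ/σ`, and exchange the two
integrals (`meanValue_mul_le_integral_genDiff`). Everything then rests on the scalar inequality
`𝓘(ψ) ≤ ∫₀¹ ψ(cu) V*(u) du` for `c ≥ 7π/5` (`IsClassPsi.meanValue_le_integral`), used with
`c = γ|s|/σ` for `|s| ≥ σ`. It yields the quadratic case `p = 2`; Bernoulli's inequality
passes to `p > 2` (`le_avgModulus`), and the maximum of the differences dominates their quadratic
mean (`le_modulus`).

For the scalar inequality, put `f(u) = ψ(cu) - 𝓘(ψ)`, a continuous even function of mean zero with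
period `T = 2π/c ≤ 10/7`. The averaging hypothesis on `ψ` says that the primitive `g` of `f` is
nonpositive on `[0, T/2]`, so `G(u) = -∫₀ᵘ g` is nonnegative, even, `T`-periodic, and increasing on
`[0, T/2]`. Two integrations by parts give
`∫₀¹ f Z = ∫_{1/7}^{5/7} G - ∫_{5/7}^{1} G`, and this is nonnegative
(`integral_le_of_even_periodic_monotoneOn`): the interval `[5/7, 1]` can be carried into
`[1/7, 5/7]` by a translation or a reflection under which `G` does not decrease. Which one
depends on the size of `T`; at the endpoint `T = 10/7` it is the reflection about `5/7`.
-/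

namespace JacksonStechkin

/-! ### The weight -/

theorem continuous_weightZ : Continuous weightZ := by
  unfold weightZ
  refine Continuous.if_le (by fun_prop) (Continuous.if_le (by fun_prop) (by fun_prop)
    continuous_id continuous_const ?_) continuous_id continuous_const ?_
  · rintro t rfl; norm_num
  · rintro t rfl; norm_num

theorem weightZ_nonneg {t : ℝ} (h0 : 0 ≤ t) : 0 ≤ weightZ t := by
  unfold weightZ
  split_ifs with h1 h2
  · positivity
  · push Not at h1
    nlinarith [mul_nonneg (sub_nonneg.2 h1.le) (sub_nonneg.2 h2)]
  · nlinarith [sq_nonneg (t - 1)]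

theorem integral_weightZ_pos : 0 < ∫ u in (0 : ℝ)..1, weightZ u :=
  intervalIntegral.integral_pos one_pos continuous_weightZ.continuousOn
    (fun _ hu => weightZ_nonneg hu.1.le) ⟨1 / 7, by norm_num, by norm_num [weightZ]⟩

theorem integral_abs_weightZ :
    ∫ u in (0 : ℝ)..1, |weightZ u| = ∫ u in (0 : ℝ)..1, weightZ u :=
  intervalIntegral.integral_congr fun u hu => by
    rw [uIcc_of_le zero_le_one] at hu
    exact abs_of_nonneg (weightZ_nonneg hu.1)

theorem continuous_weightVstar : Continuous weightVstar :=
  continuous_weightZ.div_const _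

theorem weightVstar_nonneg {t : ℝ} (h0 : 0 ≤ t) : 0 ≤ weightVstar t := by
  unfold weightVstar
  rw [integral_abs_weightZ]
  exact div_nonneg (weightZ_nonneg h0) integral_weightZ_pos.le

theorem integral_weightVstar : ∫ u in (0 : ℝ)..1, weightVstar u = 1 := by
  unfold weightVstar
  rw [intervalIntegral.integral_div, integral_abs_weightZ, div_self integral_weightZ_pos.ne']

/-! ### The extremal inequality for periodic functions -/

/-- Integration by parts, twice, against a quadratic polynomial: `g` and `G` are the first and
second antiderivatives of `f`. -/
theorem integral_mul_quadratic {f g G : ℝ → ℝ} (hf : Continuous f)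
    (hg : ∀ u, HasDerivAt g (f u) u) (hG : ∀ u, HasDerivAt G (g u) u) (α β κ p q : ℝ) :
    ∫ u in p..q, f u * (α * u ^ 2 + β * u + κ)
      = (g q * (α * q ^ 2 + β * q + κ) - G q * (2 * α * q + β))
        - (g p * (α * p ^ 2 + β * p + κ) - G p * (2 * α * p + β))
        + 2 * α * ∫ u in p..q, G u := by
  have hGc : Continuous G := continuous_iff_continuousAt.2 fun u => (hG u).continuousAt
  have hd : ∀ u, HasDerivAt
      (fun u => g u * (α * u ^ 2 + β * u + κ) - G u * (2 * α * u + β))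
      (f u * (α * u ^ 2 + β * u + κ) - 2 * α * G u) u := by
    intro u
    have h1 : HasDerivAt (fun u : ℝ => α * u ^ 2 + β * u + κ) (2 * α * u + β) u := by
      refine ((((hasDerivAt_id' u).fun_pow 2).const_mul α).fun_add
        ((hasDerivAt_id' u).const_mul β)).add_const κ |>.congr_deriv ?_
      norm_num; ring
    have h2 : HasDerivAt (fun u : ℝ => 2 * α * u + β) (2 * α) u := by
      simpa using ((hasDerivAt_id' u).const_mul (2 * α)).add_const β
    refine ((hg u).fun_mul h1).fun_sub ((hG u).fun_mul h2) |>.congr_deriv ?_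
    ring
  have h := intervalIntegral.integral_eq_sub_of_hasDerivAt (fun u _ => hd u)
    ((by fun_prop : Continuous fun u =>
      f u * (α * u ^ 2 + β * u + κ) - 2 * α * G u).intervalIntegrable p q)
  rw [intervalIntegral.integral_sub
    ((by fun_prop : Continuous fun u => f u * (α * u ^ 2 + β * u + κ)).intervalIntegrable p q)
    ((by fun_prop : Continuous fun u => 2 * α * G u).intervalIntegrable p q),
    intervalIntegral.integral_const_mul] at h
  linarith

/-- Reduction of the pairing of `f` with `Z` to its second antiderivative `G`: `Z''` is
`-1` on `(1/7, 5/7)` and `1` on `(5/7, 1)`, while the boundary terms vanish because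
`g 0 = G 0 = 0` and `Z 1 = Z' 1 = 0`. -/
theorem integral_mul_weightZ {f g G : ℝ → ℝ} (hf : Continuous f)
    (hg : ∀ u, HasDerivAt g (f u) u) (hG : ∀ u, HasDerivAt G (g u) u)
    (hg0 : g 0 = 0) (hG0 : G 0 = 0) :
    ∫ u in (0 : ℝ)..1, f u * weightZ u
      = (∫ u in (5 / 7 : ℝ)..1, G u) - ∫ u in (1 / 7 : ℝ)..(5 / 7), G u := by
  have hc : Continuous fun u => f u * weightZ u := hf.mul continuous_weightZ
  have h1 : ∫ u in (0 : ℝ)..(1 / 7), f u * weightZ u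
      = ∫ u in (0 : ℝ)..(1 / 7), f u * (0 * u ^ 2 + 2 / 7 * u + 0) := by
    refine intervalIntegral.integral_congr fun u hu => ?_
    rw [uIcc_of_le (by norm_num)] at hu
    simp only [weightZ, if_pos hu.2]
    ring
  have h2 : ∫ u in (1 / 7 : ℝ)..(5 / 7), f u * weightZ u
      = ∫ u in (1 / 7 : ℝ)..(5 / 7), f u * ((-1 / 2) * u ^ 2 + 3 / 7 * u + (-1 / 98)) := by
    refine intervalIntegral.integral_congr fun u hu => ?_
    rw [uIcc_of_le (by norm_num)] at hu
    rcases hu.1.eq_or_lt with h | h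
    · subst h; norm_num [weightZ]
    · simp only [weightZ, if_neg h.not_ge, if_pos hu.2]
      ring
  have h3 : ∫ u in (5 / 7 : ℝ)..1, f u * weightZ u
      = ∫ u in (5 / 7 : ℝ)..1, f u * (1 / 2 * u ^ 2 + (-1) * u + 1 / 2) := by
    refine intervalIntegral.integral_congr fun u hu => ?_
    rw [uIcc_of_le (by norm_num)] at hu
    rcases hu.1.eq_or_lt with h | h
    · subst h; norm_num [weightZ]
    · simp only [weightZ, if_neg h.not_ge, if_neg (show ¬ u ≤ 1 / 7 by linarith)]
      ring
  rw [← intervalIntegral.integral_add_adjacent_intervals (hc.intervalIntegrable 0 (1 / 7))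
      (hc.intervalIntegrable (1 / 7) 1),
    ← intervalIntegral.integral_add_adjacent_intervals (hc.intervalIntegrable (1 / 7) (5 / 7))
      (hc.intervalIntegrable (5 / 7) 1), h1, h2, h3, integral_mul_quadratic hf hg hG,
    integral_mul_quadratic hf hg hG, integral_mul_quadratic hf hg hG, hg0, hG0]
  ring

/-- For an even `T`-periodic function which increases on `[0, T/2]` (and hence decreases on
`[T/2, T]`), the integral over `[5/7, 1]` is dominated by the integral over `[1/7, 5/7]`,
provided `T ≤ 10/7`. -/
theorem integral_le_of_even_periodic_monotoneOn {G : ℝ → ℝ} {T : ℝ} (hT : 0 < T)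
    (hT' : T ≤ 10 / 7) (hc : Continuous G) (hp : Function.Periodic G T)
    (heven : ∀ u, G (-u) = G u) (hmono : MonotoneOn G (Icc 0 (T / 2))) (h0 : 0 ≤ G 0) :
    ∫ u in (5 / 7 : ℝ)..1, G u ≤ ∫ u in (1 / 7 : ℝ)..(5 / 7), G u := by
  have hrefl : ∀ u, G (T - u) = G u := fun u => by rw [hp.sub_eq', heven]
  have hle : ∀ y x, 0 ≤ y → y ≤ x → x ≤ T - y → G y ≤ G x := by
    intro y x hy hyx hxy
    rcases le_total x (T / 2) with h | h
    · exact hmono ⟨hy, hyx.trans h⟩ ⟨hy.trans hyx, h⟩ hyx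
    · rw [← hrefl x]
      exact hmono ⟨hy, by linarith⟩ ⟨by linarith, by linarith⟩ (by linarith)
  have hnn : ∀ u, 0 ≤ G u := by
    intro u
    obtain ⟨y, hy, hxy⟩ := hp.exists_mem_Ico₀ hT u
    rw [hxy]
    exact h0.trans (hle 0 y le_rfl hy.1 (by linarith [hy.2]))
  have hsub : ∀ p, 1 / 7 ≤ p → p ≤ 3 / 7 →
      ∫ u in p..(p + 2 / 7), G u ≤ ∫ u in (1 / 7 : ℝ)..(5 / 7), G u := fun p h1 h2 =>
    intervalIntegral.integral_mono_interval h1 (by linarith) (by linarith)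
      (ae_of_all _ hnn) (hc.intervalIntegrable _ _)
  -- It suffices to dominate `G` on `[5/7, 1]` by a translate or a reflection of `G` which
  -- carries this interval into `[1/7, 5/7]`.
  have htrans : ∀ d, 2 / 7 ≤ d → d ≤ 4 / 7 → (∀ u ∈ Icc (5 / 7 : ℝ) 1, G u ≤ G (u - d)) →
      ∫ u in (5 / 7 : ℝ)..1, G u ≤ ∫ u in (1 / 7 : ℝ)..(5 / 7), G u := by
    intro d h1 h2 h
    refine (intervalIntegral.integral_mono_on (by norm_num) (hc.intervalIntegrable _ _)
      ((by fun_prop : Continuous fun u => G (u - d)).intervalIntegrable _ _) h).trans ?_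
    refine le_of_eq_of_le ?_ (hsub (5 / 7 - d) (by linarith) (by linarith))
    rw [intervalIntegral.integral_comp_sub_right]
    congr 1
    ring
  have hreflect : ∀ m : ℕ, 8 / 7 ≤ m * T → m * T ≤ 10 / 7 →
      ∫ u in (5 / 7 : ℝ)..1, G u ≤ ∫ u in (1 / 7 : ℝ)..(5 / 7), G u := by
    intro m h1 h2
    have h3 : ∀ u, G (m * T - u) = G u := fun u => by
      rw [← heven u, sub_eq_neg_add]; exact hp.nat_mul m _
    refine le_of_eq_of_le ?_ (hsub (m * T - 1) (by linarith) (by linarith))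
    have := intervalIntegral.integral_comp_sub_left (a := 5 / 7) (b := 1) G (m * T)
    simp only [h3] at this
    rw [this]
    congr 1
    ring
  by_cases hT1 : T ≤ 4 / 7
  · -- a multiple of the period lies in `[2/7, 4/7]`
    set m := ⌊(4 / 7) / T⌋₊ with hm
    have hm1 : (m : ℝ) * T ≤ 4 / 7 := (le_div_iff₀ hT).1 (Nat.floor_le (by positivity))
    have hm2 : 4 / 7 < ((m : ℝ) + 1) * T := (div_lt_iff₀ hT).1 (Nat.lt_floor_add_one _)
    have hm3 : 1 ≤ (m : ℝ) := by
      have : 1 ≤ m := Nat.le_floor (by rw [Nat.cast_one]; exact (one_le_div hT).2 hT1)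
      exact_mod_cast this
    refine htrans (m * T) (by nlinarith) hm1 fun u _ => ?_
    exact (hp.sub_nat_mul_eq m).ge
  by_cases hT2 : T ≤ 5 / 7
  · exact hreflect 2 (by push_cast; linarith) (by push_cast; linarith)
  by_cases hT5 : 8 / 7 ≤ T
  · exact hreflect 1 (by simpa using hT5) (by simpa using hT')
  push Not at hT1 hT2 hT5
  -- For `T ∈ (5/7, 8/7)` no symmetry of `G` carries `[5/7, 1]` into `[1/7, 5/7]`. Instead a
  -- translation brings each point at least as close, modulo `T`, to the maximum point `T/2`.
  have hfold : ∀ u v, v ≤ u → T ≤ u + v → u + v ≤ 2 * T → u - v ≤ T → G u ≤ G v := by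
    intro u v h1 h2 h3 h4
    rcases le_total u T with h | h
    · rw [← hrefl u]
      exact hle _ _ (by linarith) (by linarith) (by linarith)
    · rw [← hp.sub_eq u]
      exact hle _ _ (by linarith) (by linarith) (by linarith)
  by_cases hT3 : T ≤ 6 / 7
  · exact htrans (4 / 7) (by norm_num) le_rfl fun u hu =>
      hfold _ _ (by linarith) (by linarith [hu.1]) (by linarith [hu.2]) (by linarith)
  · push Not at hT3
    exact htrans (2 / 7) le_rfl (by norm_num) fun u hu =>
      hfold _ _ (by linarith) (by linarith [hu.1]) (by linarith [hu.2]) (by linarith)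

/-- A continuous even periodic function of mean zero whose primitive is nonpositive on half a
period has nonnegative integral against `Z`: minus its second antiderivative satisfies the
hypotheses of `integral_le_of_even_periodic_monotoneOn`. -/
theorem integral_mul_weightZ_nonneg {f : ℝ → ℝ} {T : ℝ} (hT : 0 < T) (hT' : T ≤ 10 / 7)
    (hf : Continuous f) (hp : Function.Periodic f T) (heven : ∀ u, f (-u) = f u)
    (hmean : ∫ u in (0 : ℝ)..T, f u = 0)
    (hneg : ∀ t ∈ Icc 0 (T / 2), ∫ u in (0 : ℝ)..t, f u ≤ 0) :
    0 ≤ ∫ u in (0 : ℝ)..1, f u * weightZ u := by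
  set g : ℝ → ℝ := fun t => ∫ u in (0 : ℝ)..t, f u with hgdef
  have hgd : ∀ u, HasDerivAt g (f u) u := fun u =>
    intervalIntegral.integral_hasDerivAt_right (hf.intervalIntegrable _ _)
      hf.aestronglyMeasurable.stronglyMeasurableAtFilter hf.continuousAt
  have hgc : Continuous g := continuous_iff_continuousAt.2 fun u => (hgd u).continuousAt
  have hgodd : ∀ u, g (-u) = -g u := fun t => by
    have := intervalIntegral.integral_comp_neg (a := 0) (b := t) f
    simp only [heven, neg_zero] at this
    simp only [hgdef]
    rw [this, intervalIntegral.integral_symm]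
  have hgp : Function.Periodic g T := fun u => by
    have := hp.intervalIntegral_add_eq u 0
    rw [zero_add, hmean] at this
    simp only [hgdef]
    rw [← intervalIntegral.integral_add_adjacent_intervals (hf.intervalIntegrable 0 u)
      (hf.intervalIntegrable u (u + T)), this, add_zero]
  set G : ℝ → ℝ := fun t => ∫ u in (0 : ℝ)..t, g u with hGdef
  have hGd : ∀ u, HasDerivAt G (g u) u := fun u =>
    intervalIntegral.integral_hasDerivAt_right (hgc.intervalIntegrable _ _)
      hgc.aestronglyMeasurable.stronglyMeasurableAtFilter hgc.continuousAt
  have hGc : Continuous G := continuous_iff_continuousAt.2 fun u => (hGd u).continuousAt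
  have hGeven : ∀ u, G (-u) = G u := fun t => by
    have := intervalIntegral.integral_comp_neg (a := 0) (b := t) g
    simp only [hgodd, neg_zero, intervalIntegral.integral_neg] at this
    simp only [hGdef]
    rw [intervalIntegral.integral_symm, ← this, neg_neg]
  have hGp : Function.Periodic G T := fun u => by
    have h1 := hgp.intervalIntegral_add_eq u (-(T / 2))
    have h2 : ∫ u in (-(T / 2))..(-(T / 2) + T), g u = 0 := by
      rw [show -(T / 2) + T = T / 2 by ring, ← intervalIntegral.integral_add_adjacent_intervals
        (hgc.intervalIntegrable (-(T / 2)) 0) (hgc.intervalIntegrable 0 (T / 2)),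
        intervalIntegral.integral_symm]
      have := hGeven (T / 2)
      simp only [hGdef] at this
      rw [this]; ring
    simp only [hGdef]
    rw [← intervalIntegral.integral_add_adjacent_intervals (hgc.intervalIntegrable 0 u)
      (hgc.intervalIntegrable u (u + T)), h1, h2, add_zero]
  have hmono : MonotoneOn (fun u => -G u) (Icc 0 (T / 2)) := by
    refine monotoneOn_of_deriv_nonneg (convex_Icc _ _) hGc.neg.continuousOn
      (fun u _ => (hGd u).neg.differentiableAt.differentiableWithinAt) fun u hu => ?_
    rw [(hGd u).fun_neg.deriv]
    exact neg_nonneg.2 (hneg u (interior_subset hu))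
  have h := integral_le_of_even_periodic_monotoneOn hT hT' hGc.neg
    (fun u => congrArg Neg.neg (hGp u)) (fun u => congrArg Neg.neg (hGeven u)) hmono
    (by simp [hGdef])
  rw [integral_mul_weightZ hf hgd hGd (by simp [hgdef]) (by simp [hGdef])]
  simp only [Pi.neg_apply, intervalIntegral.integral_neg] at h
  linarith

/-! ### Mean values of functions of the class `Ψ` -/

theorem IsClassPsi.meanValue_eq {ψ : ℝ → ℝ} (h : IsClassPsi ψ) :
    meanValue ψ = 1 / Real.pi * ∫ t in (0 : ℝ)..Real.pi, ψ t := by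
  have h1 : ∫ t in Real.pi..(2 * Real.pi), ψ t = ∫ t in (0 : ℝ)..Real.pi, ψ t := by
    have h2 := intervalIntegral.integral_comp_sub_left (a := 0) (b := Real.pi) ψ (2 * Real.pi)
    have h3 : ∀ t, ψ (2 * Real.pi - t) = ψ t := fun t => by
      rw [h.periodic.sub_eq', h.even]
    simp only [h3, sub_zero] at h2
    rw [h2]; congr 1; ring
  rw [meanValue, ← intervalIntegral.integral_add_adjacent_intervals
    (h.continuous.intervalIntegrable 0 Real.pi) (h.continuous.intervalIntegrable _ _), h1]
  field_simp
  ring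

/-- Without positivity the factor `1 / √𝓘(ψ)` of the Jackson inequality would be the junk value
`0`; it holds because a nowhere dense set is not the whole line. -/
theorem IsClassPhi.meanValue_pos {ψ : ℝ → ℝ} (h : IsClassPhi ψ) : 0 < meanValue ψ := by
  have hpi := Real.pi_pos
  obtain ⟨t, ht⟩ : ∃ t, ψ t ≠ 0 := by
    by_contra! hall
    have := h.nowhereDense_zeros
    simp [IsNowhereDense, hall] at this
  obtain ⟨y, hy, hty⟩ := h.periodic.exists_mem_Ico₀ (by positivity) t
  refine mul_pos (by positivity) (intervalIntegral.integral_pos (by positivity)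
    h.continuous.continuousOn (fun u _ => h.nonneg u) ⟨y, Ico_subset_Icc_self hy, ?_⟩)
  rw [← hty]
  exact (h.nonneg t).lt_of_ne' ht

/-- The inequality that singles out the weight `V*` and the constant `7π/5`: apply
`integral_mul_weightZ_nonneg` to `u ↦ ψ(cu) - 𝓘(ψ)`, whose period `2π/c` is at most `10/7`. -/
theorem IsClassPsi.meanValue_le_integral {ψ : ℝ → ℝ} (h : IsClassPsi ψ) {c : ℝ}
    (hc : 7 * Real.pi / 5 ≤ c) :
    meanValue ψ ≤ ∫ u in (0 : ℝ)..1, ψ (c * u) * weightVstar u := by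
  have hpi := Real.pi_pos
  have hc0 : 0 < c := by linarith
  have hcont : Continuous fun u => ψ (c * u) := h.continuous.comp (by fun_prop)
  set I := meanValue ψ with hI
  have hprim : ∀ t, ∫ u in (0 : ℝ)..t, (ψ (c * u) - I)
      = c⁻¹ * ((∫ s in (0 : ℝ)..(c * t), ψ s) - c * t * I) := by
    intro t
    rw [intervalIntegral.integral_sub (hcont.intervalIntegrable _ _) (by simp),
      intervalIntegral.integral_comp_mul_left _ hc0.ne']
    simp
    field_simp
  have key := integral_mul_weightZ_nonneg (f := fun u => ψ (c * u) - I) (T := 2 * Real.pi / c)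
    (by positivity) (by rw [div_le_iff₀ hc0]; linarith) (hcont.sub continuous_const)
    (fun u => by
      show ψ (c * (u + 2 * Real.pi / c)) - I = _
      rw [mul_add, mul_div_cancel₀ _ hc0.ne', h.periodic])
    (fun u => by show ψ (c * -u) - I = _; rw [mul_neg, h.even])
    (by
      rw [hprim, mul_div_cancel₀ _ hc0.ne', hI, meanValue]
      field_simp
      ring)
    (by
      intro t ht
      rw [hprim]
      refine mul_nonpos_of_nonneg_of_nonpos (by positivity) ?_
      have hct : c * t ≤ Real.pi := by
        have := mul_le_mul_of_nonneg_left ht.2 hc0.le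
        rwa [div_div, mul_comm c 2, mul_div_mul_left _ _ two_ne_zero,
          mul_div_cancel₀ _ hc0.ne'] at this
      have hct0 : 0 ≤ c * t := mul_nonneg hc0.le ht.1
      rcases hct0.eq_or_lt with h0 | h0
      · simp [← h0]
      have hI' := h.meanValue_eq
      rcases hct.eq_or_lt with h1 | h1
      · rw [h1, hI, hI']; field_simp; simp
      · have := h.average_le _ ⟨h0, h1⟩
        rw [← hI', ← hI, one_div, inv_mul_le_iff₀ h0] at this
        linarith)
  have h2 : ∫ u in (0 : ℝ)..1, (ψ (c * u) - I) * weightZ u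
      = (∫ u in (0 : ℝ)..1, ψ (c * u) * weightZ u) - I * ∫ u in (0 : ℝ)..1, weightZ u := by
    simp only [sub_mul]
    rw [intervalIntegral.integral_sub ((hcont.fun_mul continuous_weightZ).intervalIntegrable _ _)
      ((continuous_const.fun_mul continuous_weightZ).intervalIntegrable _ _),
      intervalIntegral.integral_const_mul]
  simp only [weightVstar, integral_abs_weightZ, ← mul_div_assoc]
  rw [intervalIntegral.integral_div, le_div_iff₀ integral_weightZ_pos]
  linarith

/-! ### Spectral integrals and generalized differences -/

section
variable {H : Type*} [NormedAddCommGroup H] [InnerProductSpace ℂ H] [CompleteSpace H]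
  (E : ResolutionOfIdentity H)

/-- The isometry property of the spectral integral:
`‖∫ F(s) dE(s) x‖² = ∫ |F(s)|² d(E(s)x, x)`. -/
theorem ResolutionOfIdentity.enorm_integral (F : ℝ → ℂ) (hF : Measurable F) (x : H)
    (hF2 : MemLp F 2 (E.scalarMeasure x)) :
    ‖E.integral F hF x‖ₑ = eLpNorm F 2 (E.scalarMeasure x) := by
  set A : ℕ → SimpleFunc ℝ ℂ := fun n => SimpleFunc.approxOn F hF univ 0 (mem_univ 0) n
  have hA : Tendsto (fun n => eLpNorm (⇑(A n) - F) 2 (E.scalarMeasure x)) atTop (𝓝 0) :=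
    SimpleFunc.tendsto_approxOn_Lp_eLpNorm hF (mem_univ 0) (by norm_num) (by simp)
      (by simpa using hF2.2)
  have h1 := (E.tendsto_simpleIntegral F hF x hF2 A hA).enorm
  simp only [E.enorm_simpleIntegral] at h1
  refine tendsto_nhds_unique h1 ?_
  refine tendsto_of_tendsto_of_tendsto_of_le_of_le
    (g := fun n => eLpNorm F 2 (E.scalarMeasure x) - eLpNorm (⇑(A n) - F) 2 (E.scalarMeasure x))
    (h := fun n => eLpNorm F 2 (E.scalarMeasure x) + eLpNorm (⇑(A n) - F) 2 (E.scalarMeasure x))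
    ?_ ?_ ?_ ?_
  · simpa using ENNReal.Tendsto.sub (tendsto_const_nhds (x := eLpNorm F 2 (E.scalarMeasure x)))
      hA (Or.inl hF2.2.ne)
  · simpa using tendsto_const_nhds.add hA
  · intro n
    rw [tsub_le_iff_right]
    have h := eLpNorm_sub_le (μ := E.scalarMeasure x) (p := 2) (A n).aestronglyMeasurable
      ((A n).aestronglyMeasurable.sub hF.aestronglyMeasurable) (by norm_num)
    simpa using h
  · intro n
    have h := eLpNorm_add_le (μ := E.scalarMeasure x) (p := 2) hF.aestronglyMeasurable
      ((A n).aestronglyMeasurable.sub hF.aestronglyMeasurable) (by norm_num)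
    simpa using h

theorem continuous_psi (φ : C(ℂ, ℂ)) : Continuous (psi φ) := by
  unfold psi; fun_prop

theorem exists_psi_le (φ : C(ℂ, ℂ)) : ∃ C, ∀ t, psi φ t ≤ C := by
  obtain ⟨C, hC⟩ := (isCompact_sphere (0 : ℂ) 1).exists_bound_of_continuousOn
    φ.continuous.continuousOn
  refine ⟨C ^ 2, fun t => ?_⟩
  unfold psi
  gcongr
  refine hC _ ?_
  rw [mem_sphere_zero_iff_norm, mul_comm]
  exact Complex.norm_exp_ofReal_mul_I t

/-- `‖Δ_t^φ x‖² = ∫ ψ(ts) d(E(s)x, x)`. -/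
theorem norm_genDiff_sq (φ : C(ℂ, ℂ)) (t : ℝ) (x : H) :
    ‖genDiff E φ t x‖ ^ 2 = ∫ s, psi φ (t * s) ∂E.scalarMeasure x := by
  have hF : Continuous fun s : ℝ => φ (Complex.exp (Complex.I * t * s)) :=
    φ.continuous.comp (by fun_prop)
  have hpsi : ∀ s : ℝ, psi φ (t * s) = ‖φ (Complex.exp (Complex.I * t * s))‖ ^ 2 := fun s => by
    rw [psi]; push_cast; rw [mul_assoc]
  obtain ⟨C, hC⟩ := exists_psi_le φ
  have hmem : MemLp (fun s : ℝ => φ (Complex.exp (Complex.I * t * s))) 2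
      (E.scalarMeasure x) := by
    refine MemLp.of_bound hF.aestronglyMeasurable (√C) (ae_of_all _ fun s => ?_)
    refine Real.le_sqrt_of_sq_le ?_
    rw [← hpsi]
    exact hC _
  have h1 := E.enorm_integral _ hF.measurable x hmem
  have h2 := congrArg ENNReal.toReal h1
  rw [toReal_enorm] at h2
  rw [genDiff, h2, hmem.eLpNorm_eq_integral_rpow_norm (by norm_num) (by norm_num),
    ENNReal.toReal_ofReal (by positivity)]
  simp only [ENNReal.toReal_ofNat, Real.rpow_ofNat, ← hpsi]
  rw [← Real.rpow_natCast, ← Real.rpow_mul (integral_nonneg fun s => by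
    rw [hpsi]; positivity)]
  norm_num

theorem continuous_norm_genDiff (φ : C(ℂ, ℂ)) (x : H) :
    Continuous fun t => ‖genDiff E φ t x‖ := by
  obtain ⟨C, hC⟩ := exists_psi_le φ
  have h : Continuous fun t => ∫ s, psi φ (t * s) ∂E.scalarMeasure x := by
    refine continuous_of_dominated (bound := fun _ => C) ?_ ?_ (integrable_const _) ?_
    · exact fun t => ((continuous_psi φ).comp (by fun_prop)).aestronglyMeasurable
    · refine fun t => ae_of_all _ fun s => ?_
      rw [Real.norm_of_nonneg (by unfold psi; positivity)]
      exact hC _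
    · exact ae_of_all _ fun s => (continuous_psi φ).comp (by fun_prop)
  have h2 : (fun t => ‖genDiff E φ t x‖)
      = fun t => √(∫ s, psi φ (t * s) ∂E.scalarMeasure x) := by
    ext t
    rw [← norm_genDiff_sq, Real.sqrt_sq (norm_nonneg _)]
  rw [h2]
  exact h.sqrt

theorem bestApprox_le (σ : ℝ) (x : H) :
    bestApprox E σ x ≤ ‖E.proj (Ioo (-σ) σ)ᶜ x‖ := by
  have h1 := E.proj_union _ _ (measurableSet_Ioo (a := -σ) (b := σ)) measurableSet_Ioo.compl
    disjoint_compl_right x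
  rw [union_compl_self, E.proj_univ, one_apply_eq_self] at h1
  have h2 : ‖E.proj (Ioo (-σ) σ)ᶜ x‖ = ‖x - E.proj (Ioo (-σ) σ) x‖ :=
    congrArg norm (sub_eq_of_eq_add' h1).symm
  rw [h2]
  exact ciInf_le (f := fun h : spectralSubspace E σ => ‖x - h‖)
    ⟨0, by rintro _ ⟨h, rfl⟩; positivity⟩ ⟨E.proj (Ioo (-σ) σ) x, ⟨x, rfl⟩⟩

theorem norm_proj_compl_sq (σ : ℝ) (x : H) :
    ‖E.proj (Ioo (-σ) σ)ᶜ x‖ ^ 2 = (E.scalarMeasure x).real (Ioo (-σ) σ)ᶜ := by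
  rw [measureReal_def, E.scalarMeasure_apply x _ measurableSet_Ioo.compl,
    ENNReal.toReal_ofReal (by positivity)]
end

/-! ### The Jackson inequality -/

section
variable {H : Type*} [NormedAddCommGroup H] [InnerProductSpace ℂ H] [CompleteSpace H]
  (E : ResolutionOfIdentity H)

/-- The quadratic mean, rescaled to `[0, 1]`, of the generalized differences dominates
`𝓘(ψ) ‖x - E((-σ, σ)) x‖²`: exchange the integrals over `t` and over the spectrum, and apply
`IsClassPsi.meanValue_le_integral` at each spectral point `s` with `|s| ≥ σ`. -/
theorem meanValue_mul_le_integral_genDiff {φ : C(ℂ, ℂ)} (hφ : IsClassPsi (psi φ)) {γ σ : ℝ}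
    (hγ : 7 * Real.pi / 5 ≤ γ) (hσ : 0 < σ) (x : H) :
    meanValue (psi φ) * ‖E.proj (Ioo (-σ) σ)ᶜ x‖ ^ 2
      ≤ ∫ u in (0 : ℝ)..1, ‖genDiff E φ (γ / σ * u) x‖ ^ 2 * weightVstar u := by
  have hpi := Real.pi_pos
  have hγ0 : 0 < γ := by linarith
  set μ := E.scalarMeasure x
  obtain ⟨C, hC⟩ := exists_psi_le φ
  have hψ := continuous_psi φ
  have hV := continuous_weightVstar
  set k : ℝ → ℝ → ℝ := fun s u => psi φ (γ / σ * u * s) * weightVstar u with hk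
  have hkc : Continuous (Function.uncurry k) := by
    simp only [hk, Function.uncurry_def]
    fun_prop
  obtain ⟨M, hM⟩ := isCompact_Icc.exists_bound_of_continuousOn
    (hV.continuousOn (s := Icc (0 : ℝ) 1))
  have hint : Integrable (Function.uncurry k)
      (μ.prod (volume.restrict (Ioc (0 : ℝ) 1))) := by
    refine Integrable.mono' (g := fun _ => C * M) (integrable_const _)
      hkc.aestronglyMeasurable ?_
    have hae : ∀ᵐ z ∂(μ.prod (volume.restrict (Ioc (0 : ℝ) 1))), z.2 ∈ Ioc (0 : ℝ) 1 :=
      Measure.quasiMeasurePreserving_snd.ae (ae_restrict_mem measurableSet_Ioc)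
    filter_upwards [hae] with z hz
    simp only [hk, Function.uncurry_def, norm_mul]
    have h0 : 0 ≤ psi φ (γ / σ * z.2 * z.1) := hφ.nonneg _
    rw [Real.norm_of_nonneg h0]
    exact mul_le_mul (hC _) (hM _ (Ioc_subset_Icc_self hz)) (norm_nonneg _) (h0.trans (hC _))
  have hswap : ∫ u in (0 : ℝ)..1, ‖genDiff E φ (γ / σ * u) x‖ ^ 2 * weightVstar u
      = ∫ s, (∫ u in (0 : ℝ)..1, k s u) ∂μ := by
    simp only [intervalIntegral.integral_of_le zero_le_one]
    rw [integral_integral_swap hint]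
    refine integral_congr_ae (ae_of_all _ fun u => ?_)
    simp only [hk, norm_genDiff_sq, integral_mul_const]
    rfl
  have hnn : ∀ s, 0 ≤ ∫ u in (0 : ℝ)..1, k s u := fun s =>
    intervalIntegral.integral_nonneg zero_le_one fun u hu =>
      mul_nonneg (hφ.nonneg _) (weightVstar_nonneg hu.1)
  have hint' : Integrable (fun s => ∫ u in (0 : ℝ)..1, k s u) μ := by
    simp only [intervalIntegral.integral_of_le zero_le_one]
    exact hint.integral_prod_left
  rw [hswap, norm_proj_compl_sq]
  calc meanValue (psi φ) * μ.real (Ioo (-σ) σ)ᶜ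
      = ∫ _ in (Ioo (-σ) σ)ᶜ, meanValue (psi φ) ∂μ := by
        rw [setIntegral_const, smul_eq_mul, mul_comm]
    _ ≤ ∫ s in (Ioo (-σ) σ)ᶜ, (∫ u in (0 : ℝ)..1, k s u) ∂μ := by
        refine setIntegral_mono_on (integrable_const _) hint'.integrableOn
          measurableSet_Ioo.compl fun s hs => ?_
        have hs' : σ ≤ |s| := by
          by_contra! h
          exact hs (abs_lt.1 h)
        have h := hφ.meanValue_le_integral (c := γ / σ * |s|) (by
          refine hγ.trans ?_
          rw [div_mul_eq_mul_div, le_div_iff₀ hσ]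
          exact mul_le_mul_of_nonneg_left hs' hγ0.le)
        refine h.trans_eq (intervalIntegral.integral_congr fun u _ => ?_)
        simp only [hk]
        congr 1
        rcases abs_choice s with h | h <;> rw [h]
        · ring_nf
        · rw [← hφ.even]; ring_nf
    _ ≤ ∫ s, (∫ u in (0 : ℝ)..1, k s u) ∂μ :=
        setIntegral_le_integral hint' (ae_of_all _ hnn)

/-- Jensen's inequality for the probability density `V*`: the mean of order `p ≥ 2` is at least
the quadratic mean. -/
theorem le_avgModulus {φ : C(ℂ, ℂ)} {δ b : ℝ} (hδ : 0 < δ) (hb : 0 < b) (x : H)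
    (h : b ^ 2 ≤ ∫ u in (0 : ℝ)..1, ‖genDiff E φ (δ * u) x‖ ^ 2 * weightVstar u)
    {p : ℝ} (hp : 2 ≤ p) : b ≤ avgModulus E φ x p weightVstar δ := by
  have hN := continuous_norm_genDiff E φ x
  have hV := continuous_weightVstar
  have hp0 : 0 < p := by linarith
  have hscale : 1 / δ * ∫ t in (0 : ℝ)..δ, ‖genDiff E φ t x‖ ^ p * weightVstar (t / δ)
      = ∫ u in (0 : ℝ)..1, ‖genDiff E φ (δ * u) x‖ ^ p * weightVstar u := by
    have := intervalIntegral.integral_comp_mul_left (a := 0) (b := 1)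
      (fun t => ‖genDiff E φ t x‖ ^ p * weightVstar (t / δ)) hδ.ne'
    simp only [mul_div_cancel_left₀ _ hδ.ne', mul_zero, mul_one, smul_eq_mul] at this
    rw [this, one_div]
  rw [avgModulus, hscale]
  have hcN : Continuous fun u => ‖genDiff E φ (δ * u) x‖ := hN.comp (by fun_prop)
  -- Bernoulli's inequality: `y ^ (p / 2)` lies above its tangent at `y = b ^ 2`.
  have hbern : ∀ n : ℝ, 0 ≤ n → b ^ p * (1 + p / 2 * (n ^ 2 / b ^ 2 - 1)) ≤ n ^ p := by
    intro n hn
    have h1 := one_add_mul_self_le_rpow_one_add (s := n ^ 2 / b ^ 2 - 1) (p := p / 2)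
      (by have : 0 ≤ n ^ 2 / b ^ 2 := by positivity
          linarith) (by linarith)
    have h2 : (n ^ 2 / b ^ 2) ^ (p / 2) = n ^ p / b ^ p := by
      rw [← div_pow, ← Real.rpow_natCast (n / b), ← Real.rpow_mul (by positivity),
        Nat.cast_ofNat, mul_div_cancel₀ _ two_ne_zero, Real.div_rpow hn hb.le]
    rw [add_sub_cancel, h2, le_div_iff₀ (by positivity)] at h1
    linarith
  have hmain : b ^ p ≤ ∫ u in (0 : ℝ)..1, ‖genDiff E φ (δ * u) x‖ ^ p * weightVstar u := by
    have hi : ∫ u in (0 : ℝ)..1, b ^ p *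
          (1 + p / 2 * (‖genDiff E φ (δ * u) x‖ ^ 2 / b ^ 2 - 1)) * weightVstar u
        = b ^ p * (1 + p / 2 * ((∫ u in (0 : ℝ)..1, ‖genDiff E φ (δ * u) x‖ ^ 2 * weightVstar u)
          / b ^ 2 - 1)) := by
      have : ∀ u : ℝ, b ^ p * (1 + p / 2 * (‖genDiff E φ (δ * u) x‖ ^ 2 / b ^ 2 - 1))
          * weightVstar u = b ^ p * (1 - p / 2) * weightVstar u
            + b ^ p * (p / 2) / b ^ 2 * (‖genDiff E φ (δ * u) x‖ ^ 2 * weightVstar u) :=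
        fun u => by ring
      simp only [this]
      rw [intervalIntegral.integral_add
        ((by fun_prop : Continuous fun u => b ^ p * (1 - p / 2) * weightVstar u)
          |>.intervalIntegrable _ _)
        ((((hcN.fun_pow 2).fun_mul hV).const_mul _).intervalIntegrable _ _),
        intervalIntegral.integral_const_mul, intervalIntegral.integral_const_mul,
        integral_weightVstar]
      ring
    have h1 : 1 ≤ (∫ u in (0 : ℝ)..1, ‖genDiff E φ (δ * u) x‖ ^ 2 * weightVstar u) / b ^ 2 :=
      (one_le_div (by positivity)).2 h
    calc b ^ p ≤ b ^ p * (1 + p / 2 *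
          ((∫ u in (0 : ℝ)..1, ‖genDiff E φ (δ * u) x‖ ^ 2 * weightVstar u) / b ^ 2 - 1)) := by
          refine le_mul_of_one_le_right (by positivity) ?_
          have := mul_nonneg (by positivity : 0 ≤ p / 2) (sub_nonneg.2 h1)
          linarith
      _ ≤ _ := by
          rw [← hi]
          refine intervalIntegral.integral_mono_on zero_le_one
            (Continuous.intervalIntegrable (by fun_prop) _ _)
            (((hcN.rpow_const fun _ => Or.inr hp0.le).fun_mul hV).intervalIntegrable _ _)
            fun u hu => ?_
          exact mul_le_mul_of_nonneg_right (hbern _ (norm_nonneg _)) (weightVstar_nonneg hu.1)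
  calc b = (b ^ p) ^ (1 / p) := by
        rw [← Real.rpow_mul hb.le, mul_one_div_cancel hp0.ne', Real.rpow_one]
    _ ≤ _ := Real.rpow_le_rpow (by positivity) hmain (by positivity)

theorem le_modulus {φ : C(ℂ, ℂ)} {δ b : ℝ} (hδ : 0 < δ) (x : H)
    (h : b ^ 2 ≤ ∫ u in (0 : ℝ)..1, ‖genDiff E φ (δ * u) x‖ ^ 2 * weightVstar u) :
    b ≤ modulus E φ x δ := by
  have hN := continuous_norm_genDiff E φ x
  have hV := continuous_weightVstar
  have hbdd : BddAbove ((fun t => ‖genDiff E φ t x‖) '' Icc 0 δ) :=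
    isCompact_Icc.bddAbove_image hN.continuousOn
  have hle : ∀ t ∈ Icc 0 δ, ‖genDiff E φ t x‖ ≤ modulus E φ x δ := fun t ht =>
    le_csSup hbdd ⟨t, ht, rfl⟩
  have h0 : 0 ≤ modulus E φ x δ := (norm_nonneg _).trans (hle 0 ⟨le_rfl, hδ.le⟩)
  refine le_of_sq_le_sq ?_ h0
  refine h.trans ?_
  have hcN : Continuous fun u => ‖genDiff E φ (δ * u) x‖ := hN.comp (by fun_prop)
  calc _ ≤ ∫ u in (0 : ℝ)..1, modulus E φ x δ ^ 2 * weightVstar u := by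
        refine intervalIntegral.integral_mono_on zero_le_one
          (((hcN.pow 2).fun_mul hV).intervalIntegrable _ _)
          (Continuous.intervalIntegrable (by fun_prop) _ _) fun u hu => ?_
        refine mul_le_mul_of_nonneg_right (pow_le_pow_left₀ (norm_nonneg _) (hle _ ⟨?_, ?_⟩) 2)
          (weightVstar_nonneg hu.1)
        · exact mul_nonneg hδ.le hu.1
        · exact mul_le_of_le_one_right hδ.le hu.2
    _ = modulus E φ x δ ^ 2 := by
        rw [intervalIntegral.integral_const_mul, integral_weightVstar, mul_one]
end

end JacksonStechkin

theorem mainTheorem4 {H : Type*} [NormedAddCommGroup H] [InnerProductSpace ℂ H] [CompleteSpace H]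
    (E : JacksonStechkin.ResolutionOfIdentity H) (φ : C(ℂ, ℂ))
    (hφ : JacksonStechkin.IsClassPsi (JacksonStechkin.psi φ))
    (γ : ℝ) (hγ : 7 * Real.pi / 5 ≤ γ) (x : H) (σ : ℝ) (hσ : 0 < σ) :
    (∀ p : ℝ, 2 ≤ p →
      JacksonStechkin.bestApprox E σ x ≤
        1 / √(JacksonStechkin.meanValue (JacksonStechkin.psi φ)) *
          JacksonStechkin.avgModulus E φ x p JacksonStechkin.weightVstar (γ / σ)) ∧
    JacksonStechkin.bestApprox E σ x ≤
      1 / √(JacksonStechkin.meanValue (JacksonStechkin.psi φ)) *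
        JacksonStechkin.modulus E φ x (γ / σ) := by
  open JacksonStechkin in
  have hγ0 : 0 < γ := lt_of_lt_of_le (by positivity) hγ
  have hδ : 0 < γ / σ := div_pos hγ0 hσ
  have hI : 0 < √(meanValue (psi φ)) := Real.sqrt_pos.2 hφ.meanValue_pos
  set b := √(meanValue (psi φ)) * ‖E.proj (Ioo (-σ) σ)ᶜ x‖ with hb
  have hkey : b ^ 2 ≤ ∫ u in (0 : ℝ)..1, ‖genDiff E φ (γ / σ * u) x‖ ^ 2 * weightVstar u := by
    rw [hb, mul_pow, Real.sq_sqrt hφ.meanValue_pos.le]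
    exact meanValue_mul_le_integral_genDiff E hφ hγ hσ x
  have hred : ∀ M, b ≤ M → bestApprox E σ x ≤ 1 / √(meanValue (psi φ)) * M := by
    intro M hM
    refine (bestApprox_le E σ x).trans ?_
    rw [one_div, ← div_eq_inv_mul, le_div_iff₀ hI, mul_comm]
    exact hM
  refine ⟨fun p hp => hred _ ?_, hred _ (le_modulus E hδ x hkey)⟩
  have hb0 : 0 ≤ b := by positivity
  rcases hb0.eq_or_lt with h0 | h0
  · rw [← h0]
    refine Real.rpow_nonneg (mul_nonneg (by positivity)
      (intervalIntegral.integral_nonneg hδ.le fun t ht => mul_nonneg (by positivity)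
        (weightVstar_nonneg (div_nonneg ht.1 hδ.le)))) _
  · exact le_avgModulus E hδ h0 x hkey hp
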